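/- Let $\Omega\subseteq\mathbb{R}^n$ be open and connected, let $S(m)$ be the space of real symmetric $m\times m$ matrices, and let $H\in C^1(\Omega,S(m))$. For $x\in\Omega$ let $\lambda_1(x)\le\dots\le\lambda_m(x)$ be the eigenvalues of $H(x)$ repeated according to multiplicity, and let $P_i(x)$ be the symmetric matrix of the orthogonal projection of $\mathbb{R}^m$ onto the eigenspace $\{\xi\in\mathbb{R}^m : H(x)\xi=\lambda_i(x)\xi\}$. For $1\le j\le m$ let $$A_j(x)=\sum_{\substack{1\le i\le m\\ \lambda_i(x)\ne\lambda_j(x)}}\frac{P_i(x)/d_i(x)}{\lambda_j(x)-\lambda_i(x)},\qquad d_i(x)=\operatorname{tr}P_i(x),$$ which is the pseudoinverse of $\lambda_j(x)I-H(x)$. For a differentiable $F\colon\Omega\to\mathbb{R}^{m\times k}$, $q\in\mathbb{R}^k$ and $e\in\mathbb{R}^n$, let $\nabla_qF(x)\in\mathbb{R}^{m\times n}$ denote the Jacobian matrix at $x$ of $y\mapsto F(y)q$, and let $D_eF(x)=\lim_{h\to0}\big(F(x+he)-F(x)\big)/h\in\mathbb{R}^{m\times k}$. Fix $j\in\{1,\dots,m\}$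 and assume that either $P_j$ is continuous in $\Omega$, or $\lambda_j$ is differentiable in $\Omega$ and $\operatorname{tr}P_j$ is constant in $\Omega$. Then $P_j$ is differentiable in $\Omega$, and for all $x\in\Omega$, $q\in\mathbb{R}^m$ and $e\in\mathbb{R}^n$, $$\nabla_qP_j(x)=P_j(x)\,\nabla_{A_j(x)q}H(x)+A_j(x)\,\nabla_{P_j(x)q}H(x)$$ and $$D_eP_j(x)=P_j(x)\,D_eH(x)\,A_j(x)+A_j(x)\,D_eH(x)\,P_j(x),$$ where $\nabla_{A_j(x)q}H(x)$ and $\nabla_{P_j(x)q}H(x)$ mean $\nabla_pH(x)$ with the fixed vector $p=A_j(x)q$, respectively $p=P_j(x)q$. -/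

import Mathlib

open scoped Matrix.Norms.Frobenius

noncomputable section

namespace Eigenproj

/-- The space `S(m)` of real symmetric `m × m` matrices, normed by the Frobenius norm. -/
def SymMat (m : ℕ) : Submodule ℝ (Matrix (Fin m) (Fin m) ℝ) where
  carrier := {X | X.transpose = X}
  add_mem' := by
    intro X Y hX hY
    simp only [Set.mem_ofPred_eq] at *
    rw [Matrix.transpose_add, hX, hY]
  zero_mem' := Matrix.transpose_zero
  smul_mem' := by
    intro c X hX
    simp only [Set.mem_ofPred_eq] at *
    rw [Matrix.transpose_smul, hX]

theorem SymMat.isHermitian {m : ℕ} (X : SymMat m) :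
    (X : Matrix (Fin m) (Fin m) ℝ).IsHermitian := by
  have h : (X : Matrix (Fin m) (Fin m) ℝ).transpose = X := X.2
  rw [Matrix.IsHermitian, Matrix.conjTranspose_eq_transpose_of_trivial, h]

/-- The repeated eigenvalues `λ_1 ≤ ⋯ ≤ λ_m` of a symmetric matrix, in increasing order and
counted with multiplicity. (Mathlib's `eigenvalues₀` lists them in decreasing order.) -/
def eigval {m : ℕ} (X : SymMat m) (i : Fin m) : ℝ :=
  (SymMat.isHermitian X).eigenvalues₀ (Fin.cast (Fintype.card_fin m).symm i.rev)

/-- The eigenspace `E_i = {ξ | X ξ = λ_i ξ}` in Euclidean space. -/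
def eigspace {m : ℕ} (X : SymMat m) (i : Fin m) : Submodule ℝ (EuclideanSpace ℝ (Fin m)) :=
  Module.End.eigenspace (Matrix.toEuclideanLin (X : Matrix (Fin m) (Fin m) ℝ)) (eigval X i)

/-- The eigenprojection `P_i`: the matrix of the orthogonal projection onto `E_i`. -/
def eigproj {m : ℕ} (X : SymMat m) (i : Fin m) : Matrix (Fin m) (Fin m) ℝ :=
  Matrix.toEuclideanLin.symm
    ((eigspace X i).starProjection :
      EuclideanSpace ℝ (Fin m) →ₗ[ℝ] EuclideanSpace ℝ (Fin m))

/-- The pseudoinverse `A_j` of `λ_j I - X`: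
`A_j = ∑_{i : λ_i ≠ λ_j} (P_i / d_i) / (λ_j - λ_i)` with `d_i = tr P_i`. -/
def pseudoInv {m : ℕ} (X : SymMat m) (j : Fin m) : Matrix (Fin m) (Fin m) ℝ :=
  ∑ i with eigval X i ≠ eigval X j,
    ((eigproj X i).trace * (eigval X j - eigval X i))⁻¹ • eigproj X i

/-- The Jacobian matrix of `f` at `x`: its `a`-th column is the derivative of `f` at `x` applied to
the `a`-th standard basis vector. -/
def jacobian {n k : ℕ} (f : EuclideanSpace ℝ (Fin n) → EuclideanSpace ℝ (Fin k))
    (x : EuclideanSpace ℝ (Fin n)) : Matrix (Fin k) (Fin n) ℝ :=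
  Matrix.of fun i a => fderiv ℝ f x (EuclideanSpace.single a 1) i

/-- The Jacobian derivative `∇_q F (x)`: the Jacobian matrix at `x` of `y ↦ F(y) q`. -/
def nabla {n m k : ℕ} (q : Fin k → ℝ)
    (F : EuclideanSpace ℝ (Fin n) → Matrix (Fin m) (Fin k) ℝ)
    (x : EuclideanSpace ℝ (Fin n)) : Matrix (Fin m) (Fin n) ℝ :=
  jacobian (fun y => WithLp.toLp 2 ((F y).mulVec q)) x

/-- The directional derivative `D_e F (x) = lim_{h → 0} (F(x + h e) - F(x)) / h`. -/
def dirDeriv {n m k : ℕ} (e : EuclideanSpace ℝ (Fin n))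
    (F : EuclideanSpace ℝ (Fin n) → Matrix (Fin m) (Fin k) ℝ)
    (x : EuclideanSpace ℝ (Fin n)) : Matrix (Fin m) (Fin k) ℝ :=
  lineDeriv ℝ F x e

end Eigenproj

end

namespace Eigenproj

open Matrix Filter Topology Asymptotics

/-! Write `P₀`, `S` for the eigenprojection and the pseudoinverse at `x`, `P` for the
eigenprojection at `y`, and `D`, `δ`, `R` for the increments of `H`, `λ_j`, `P_j`. Since `S (λ_j(x)
- H(x)) = 1 - P₀` and `H(y) P = λ_j(y) P`, one gets `(1 - P₀) P = S D P - δ S P`. With its transpose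
and `P₀ - P₀ P P₀ = P₀ R² P₀` this yields `R = S D P₀ + P₀ D S + T` (`eigenprojection_sub_eq`),
where each term of `T` contains `R` times a further factor `D`, `δ` or `R`. Continuity of `P_j` and
`λ_j` thus gives `T = o(R)`, hence `R = O(y - x)` and `T = o(y - x)` (`hasFDerivAt_eigproj`). Either
hypothesis provides both continuities: see `continuousAt_eigval` and `continuousAt_eigproj`. -/

/-! ### Spectral calculus of eigenprojections. -/

/-- A matrix acting diagonally on an orthonormal basis is an orthogonal conjugate of a diagonal
matrix. -/
theorem eq_conj_diagonal_of_apply_basis {m : ℕ}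
    (b : OrthonormalBasis (Fin m) ℝ (EuclideanSpace ℝ (Fin m))) (U : Matrix (Fin m) (Fin m) ℝ)
    (hU : ∀ a k, U a k = b k a) (hUU : U * Uᵀ = 1)
    (M : Matrix (Fin m) (Fin m) ℝ) (d : Fin m → ℝ)
    (h : ∀ k, toEuclideanLin M (b k) = d k • b k) : M = U * diagonal d * Uᵀ := by
  have key : M * U = U * diagonal d := by
    ext a k
    have := congrArg (fun v : EuclideanSpace ℝ (Fin m) => v a) (h k)
    simp only [ofLp_toLpLin, toLin'_apply, PiLp.smul_apply, smul_eq_mul] at this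
    rw [mul_diagonal, hU, mul_comm, ← this, mul_apply, mulVec, dotProduct]
    simp [hU]
  rw [← key, Matrix.mul_assoc, hUU, Matrix.mul_one]

/-- Simultaneous orthogonal diagonalization of a symmetric matrix and its eigenprojections. -/
theorem exists_diagonalization {m : ℕ} (X : SymMat m) :
    ∃ U : Matrix (Fin m) (Fin m) ℝ, Uᵀ * U = 1 ∧ U * Uᵀ = 1 ∧
      (X : Matrix (Fin m) (Fin m) ℝ) = U * diagonal (eigval X) * Uᵀ ∧
      ∀ i, eigproj X i =
        U * diagonal (fun k => if eigval X k = eigval X i then (1 : ℝ) else 0) * Uᵀ := by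
  have hs := isSymmetric_toEuclideanLin_iff.mpr (SymMat.isHermitian X)
  -- The reversal matches the increasing order of `eigval` to the decreasing order of
  -- `eigenvalues₀`.
  let e : Fin (Fintype.card (Fin m)) ≃ Fin m := (finCongr (Fintype.card_fin m)).trans Fin.revPerm
  let b := (hs.eigenvectorBasis finrank_euclideanSpace).reindex e
  have hb : ∀ k, toEuclideanLin (X : Matrix (Fin m) (Fin m) ℝ) (b k) = eigval X k • b k := by
    intro k
    simp only [b, OrthonormalBasis.reindex_apply]
    exact hs.apply_eigenvectorBasis finrank_euclideanSpace (e.symm k)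
  let U := (EuclideanSpace.basisFun (Fin m) ℝ).toBasis.toMatrix b.toBasis
  have hU : U ∈ unitaryGroup (Fin m) ℝ :=
    (EuclideanSpace.basisFun (Fin m) ℝ).toMatrix_orthonormalBasis_mem_unitary b
  have hUU : U * Uᵀ = 1 := mem_unitaryGroup_iff.mp hU
  have hUa : ∀ a k, U a k = b k a := fun _ _ => rfl
  refine ⟨U, mem_unitaryGroup_iff'.mp hU, hUU,
    eq_conj_diagonal_of_apply_basis b U hUa hUU _ _ hb, fun i => ?_⟩
  refine eq_conj_diagonal_of_apply_basis b U hUa hUU _ _ fun k => ?_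
  rw [eigproj, LinearEquiv.apply_symm_apply]
  change (eigspace X i).starProjection (b k) = _
  split_ifs with h
  · rw [one_smul, Submodule.starProjection_eq_self_iff, eigspace, Module.End.mem_eigenspace_iff,
      hb, h]
  · rw [zero_smul, Submodule.starProjection_apply_eq_zero_iff, Submodule.mem_orthogonal]
    intro v hv
    rw [eigspace, Module.End.mem_eigenspace_iff] at hv
    have := hs v (b k)
    rw [hv, hb, inner_smul_left, inner_smul_right] at this
    by_contra h0
    exact h (mul_right_cancel₀ h0 this).symm

theorem conj_diagonal_mul {m : ℕ} {U : Matrix (Fin m) (Fin m) ℝ} (h : Uᵀ * U = 1)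
    (d e : Fin m → ℝ) :
    (U * diagonal d * Uᵀ) * (U * diagonal e * Uᵀ) = U * diagonal (fun k => d k * e k) * Uᵀ := by
  calc _ = U * diagonal d * (Uᵀ * U) * diagonal e * Uᵀ := by simp only [Matrix.mul_assoc]
    _ = _ := by rw [h, Matrix.mul_one, Matrix.mul_assoc U, diagonal_mul_diagonal]

theorem trace_conj_diagonal {m : ℕ} {U : Matrix (Fin m) (Fin m) ℝ} (h : Uᵀ * U = 1)
    (d : Fin m → ℝ) : (U * diagonal d * Uᵀ).trace = ∑ k, d k := by
  rw [Matrix.trace_mul_comm, ← Matrix.mul_assoc, h, Matrix.one_mul, trace_diagonal]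

theorem eigproj_transpose {m : ℕ} (X : SymMat m) (j : Fin m) :
    (eigproj X j)ᵀ = eigproj X j := by
  obtain ⟨U, -, -, -, hP⟩ := exists_diagonalization X
  rw [hP]
  simp [Matrix.mul_assoc]

theorem eigproj_mul_self {m : ℕ} (X : SymMat m) (j : Fin m) :
    eigproj X j * eigproj X j = eigproj X j := by
  obtain ⟨U, hU, -, -, hP⟩ := exists_diagonalization X
  rw [hP, conj_diagonal_mul hU]
  congr 3
  ext k
  split_ifs <;> simp

theorem mul_eigproj {m : ℕ} (X : SymMat m) (j : Fin m) :
    (X : Matrix (Fin m) (Fin m) ℝ) * eigproj X j = eigval X j • eigproj X j := by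
  obtain ⟨U, hU, -, hX, hP⟩ := exists_diagonalization X
  conv_lhs => rw [hX]
  rw [hP, conj_diagonal_mul hU, ← Matrix.smul_mul, ← Matrix.mul_smul, ← diagonal_smul]
  congr 3
  ext k
  simp +contextual

theorem eigproj_mul {m : ℕ} (X : SymMat m) (j : Fin m) :
    eigproj X j * (X : Matrix (Fin m) (Fin m) ℝ) = eigval X j • eigproj X j := by
  have h := congrArg transpose (mul_eigproj X j)
  have hX : (X : Matrix (Fin m) (Fin m) ℝ)ᵀ = X := X.2
  rwa [transpose_mul, transpose_smul, eigproj_transpose, hX] at h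

/-- The rank of the eigenprojection is the multiplicity of the eigenvalue. -/
theorem trace_eigproj {m : ℕ} (X : SymMat m) (j : Fin m) :
    (eigproj X j).trace = (Finset.univ.filter fun k => eigval X k = eigval X j).card := by
  obtain ⟨U, hU, -, -, hP⟩ := exists_diagonalization X
  rw [hP, trace_conj_diagonal hU]
  simp

theorem trace_eigproj_ne_zero {m : ℕ} (X : SymMat m) (j : Fin m) :
    (eigproj X j).trace ≠ 0 := by
  rw [trace_eigproj, Nat.cast_ne_zero]
  exact (Finset.card_pos.mpr ⟨j, by simp⟩).ne'

/-! ### The pseudoinverse. -/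

/-- The pseudoinverse of `λ_j I - X` in an eigenbasis of `X`. -/
theorem pseudoInv_eq_conj_diagonal {m : ℕ} (X : SymMat m) (j : Fin m)
    {U : Matrix (Fin m) (Fin m) ℝ}
    (hP : ∀ i, eigproj X i =
      U * diagonal (fun k => if eigval X k = eigval X i then (1 : ℝ) else 0) * Uᵀ) :
    pseudoInv X j = U * diagonal (fun k => (eigval X j - eigval X k)⁻¹) * Uᵀ := by
  have hterm : ∀ i, ((eigproj X i).trace * (eigval X j - eigval X i))⁻¹ • eigproj X i =
      U * (((eigproj X i).trace * (eigval X j - eigval X i))⁻¹ •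
        diagonal (fun k => if eigval X k = eigval X i then (1 : ℝ) else 0)) * Uᵀ := by
    intro i
    conv_lhs => rw [hP i, ← Matrix.smul_mul, ← Matrix.mul_smul, ← hP i]
  rw [pseudoInv, Finset.sum_congr rfl fun i _ => hterm i, ← Finset.sum_mul, ← Finset.mul_sum]
  congr 2
  ext a k
  rw [Matrix.sum_apply]
  by_cases hak : a = k
  · subst hak
    simp only [Matrix.smul_apply, diagonal_apply_eq, smul_eq_mul, mul_ite, mul_one, mul_zero]
    rw [← Finset.sum_filter, Finset.filter_filter]
    -- On `E_j` the sum is empty, matching the convention `0⁻¹ = 0`. Elsewhere the `d_a` indices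
    -- sharing the eigenvalue `λ_a` give equal terms, which cancels the division by `d_a`.
    by_cases h : eigval X a = eigval X j
    · rw [h, sub_self, _root_.inv_zero]
      refine Finset.sum_eq_zero fun i hi => ?_
      simp only [Finset.mem_filter] at hi
      exact absurd hi.2.2.symm hi.2.1
    · have hset : (Finset.univ.filter fun i => eigval X i ≠ eigval X j ∧ eigval X a = eigval X i) =
          Finset.univ.filter fun i => eigval X i = eigval X a := by
        ext i
        simp only [Finset.mem_filter, Finset.mem_univ, true_and]
        exact ⟨fun hi => hi.2.symm, fun hi => ⟨hi ▸ h, hi.symm⟩⟩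
      have hc := trace_eigproj_ne_zero X a
      rw [hset, Finset.sum_congr rfl (g := fun _ =>
        ((eigproj X a).trace * (eigval X j - eigval X a))⁻¹), Finset.sum_const, nsmul_eq_mul,
        ← trace_eigproj, mul_inv, mul_inv_cancel_left₀ hc]
      intro i hi
      simp only [Finset.mem_filter, Finset.mem_univ, true_and] at hi
      rw [trace_eigproj, trace_eigproj, hi]
  · simp [hak]

theorem pseudoInv_mul_eigproj {m : ℕ} (X : SymMat m) (j : Fin m) :
    pseudoInv X j * eigproj X j = 0 := by
  obtain ⟨U, hU, -, -, hP⟩ := exists_diagonalization X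
  rw [pseudoInv_eq_conj_diagonal X j hP, hP, conj_diagonal_mul hU]
  have : (fun k => (eigval X j - eigval X k)⁻¹ *
      (if eigval X k = eigval X j then (1 : ℝ) else 0)) = 0 := by
    ext k
    simp +contextual
  rw [this]
  simp

theorem pseudoInv_transpose {m : ℕ} (X : SymMat m) (j : Fin m) :
    (pseudoInv X j)ᵀ = pseudoInv X j := by
  simp [pseudoInv, transpose_sum, eigproj_transpose]

theorem eigproj_mul_pseudoInv {m : ℕ} (X : SymMat m) (j : Fin m) :
    eigproj X j * pseudoInv X j = 0 := by
  have h := congrArg transpose (pseudoInv_mul_eigproj X j)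
  rwa [transpose_mul, eigproj_transpose, pseudoInv_transpose, transpose_zero] at h

/-- In an eigenbasis the diagonal entries are `(λ_j - λ_k)⁻¹ (λ_j - λ_k)`: zero on `E_j`, one off
it. -/
theorem pseudoInv_mul_sub {m : ℕ} (X : SymMat m) (j : Fin m) :
    pseudoInv X j * (eigval X j • 1 - (X : Matrix (Fin m) (Fin m) ℝ)) = 1 - eigproj X j := by
  obtain ⟨U, hU, hU', hX, hP⟩ := exists_diagonalization X
  have h1 : ∀ c : ℝ, c • (1 : Matrix (Fin m) (Fin m) ℝ) = U * diagonal (fun _ => c) * Uᵀ := by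
    intro c
    rw [← smul_one_eq_diagonal, Matrix.mul_smul, Matrix.mul_one, Matrix.smul_mul, hU']
  rw [← one_smul ℝ (1 - eigproj X j), smul_sub, h1, h1, one_smul, hP,
    pseudoInv_eq_conj_diagonal X j hP]
  conv_lhs => rw [hX]
  rw [← Matrix.sub_mul, ← Matrix.mul_sub, diagonal_sub, conj_diagonal_mul hU,
    ← Matrix.sub_mul, ← Matrix.mul_sub, diagonal_sub]
  congr 3
  ext k
  split_ifs with h
  · simp [h]
  · rw [inv_mul_cancel₀ (sub_ne_zero.mpr (Ne.symm h)), sub_zero]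

theorem sub_mul_pseudoInv {m : ℕ} (X : SymMat m) (j : Fin m) :
    (eigval X j • 1 - (X : Matrix (Fin m) (Fin m) ℝ)) * pseudoInv X j = 1 - eigproj X j := by
  have h := congrArg transpose (pseudoInv_mul_sub X j)
  have hX : (X : Matrix (Fin m) (Fin m) ℝ)ᵀ = X := X.2
  rwa [transpose_mul, transpose_sub, transpose_sub, transpose_smul, eigproj_transpose,
    pseudoInv_transpose, hX, transpose_one] at h

/-! ### Algebraic expansion of the increment. -/

/-- First-order expansion with remainder of an eigenprojection: `P₀, S` are the eigenprojection and
the reduced resolvent of `X₀` at `l₀`, and `P` is an eigenprojection of `X` at `l`. -/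
theorem eigenprojection_sub_eq {A : Type*} [Ring A] [Algebra ℝ A] {X X₀ P P₀ S : A} {l l₀ : ℝ}
    (hP : P * P = P) (hP₀ : P₀ * P₀ = P₀) (hXP : X * P = l • P) (hPX : P * X = l • P)
    (hSP : S * P₀ = 0) (hPS : P₀ * S = 0)
    (hS : S * (l₀ • 1 - X₀) = 1 - P₀) (hS' : (l₀ • 1 - X₀) * S = 1 - P₀) :
    P - P₀ = S * (X - X₀) * P₀ + P₀ * (X - X₀) * S +
      (S * (X - X₀) * (P - P₀) - (l - l₀) • (S * (P - P₀)) + P₀ * (P - P₀) * (X - X₀) * S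
        - (l - l₀) • (P₀ * (P - P₀) * S) - P₀ * (P - P₀) * (P - P₀) * P₀) := by
  have h1 : (1 - P₀) * P = S * (X - X₀) * P - (l - l₀) • (S * P) := by
    rw [← hS]
    simp only [mul_sub, sub_mul, mul_assoc, hXP, mul_smul_comm, smul_mul_assoc, mul_one, sub_smul]
    abel
  have h2 : P * (1 - P₀) = P * (X - X₀) * S - (l - l₀) • (P * S) := by
    rw [← hS']
    simp only [mul_sub, sub_mul, ← mul_assoc, hPX, mul_smul_comm, smul_mul_assoc, mul_one, sub_smul]
    abel
  have h3 : P₀ * (P - P₀) * (P - P₀) * P₀ = P₀ - P₀ * P * P₀ := by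
    have e1 : P₀ * P * P = P₀ * P := by rw [mul_assoc, hP]
    have e2 : P₀ * P * P₀ * P₀ = P₀ * P * P₀ := by rw [mul_assoc, hP₀]
    simp only [mul_sub, sub_mul, hP₀, e1, e2]
    abel
  -- Because `S P₀ = 0`, the factor `l - l₀` meets only `P - P₀`, so no derivative of the eigenvalue
  -- enters at first order.
  have h4 : S * (X - X₀) * P₀ + S * (X - X₀) * (P - P₀) - (l - l₀) • (S * (P - P₀)) =
      (1 - P₀) * P := by
    rw [h1, mul_sub S P, hSP, sub_zero]
    noncomm_ring
  have h5 : P₀ * (X - X₀) * S + P₀ * (P - P₀) * (X - X₀) * S - (l - l₀) • (P₀ * (P - P₀) * S) =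
      P₀ * (P * (1 - P₀)) := by
    rw [h2]
    simp only [mul_sub P₀ P, sub_mul (P₀ * P), hP₀, hPS, sub_zero, mul_sub P₀, mul_smul_comm,
      ← mul_assoc]
    simp only [mul_sub, sub_mul]
    abel
  calc P - P₀ = (1 - P₀) * P + P₀ * (P * (1 - P₀)) - (P₀ - P₀ * P * P₀) := by
        simp only [mul_sub, sub_mul, one_mul, mul_one, ← mul_assoc]
        abel
    _ = _ := by
        rw [← h3, ← h4, ← h5]
        abel

/-! ### Continuity of the eigenvalue and of the eigenprojection. -/

theorem sq_frobenius_norm_eq_trace {m : ℕ} (M : Matrix (Fin m) (Fin m) ℝ) :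
    ‖M‖ ^ 2 = (Mᵀ * M).trace := by
  have h0 : 0 ≤ ∑ i, ∑ k, ‖M i k‖ ^ (2 : ℝ) := by positivity
  rw [frobenius_norm_def, ← Real.sqrt_eq_rpow, Real.sq_sqrt h0, Finset.sum_comm]
  simp [trace, mul_apply, sq]

/-- An eigenvalue is continuous wherever its eigenprojection is. -/
theorem continuousAt_eigval {E : Type*} [TopologicalSpace E] {m : ℕ}
    {H : E → SymMat m} {j : Fin m} {x : E} (hH : ContinuousAt H x)
    (hP : ContinuousAt (fun y => eigproj (H y) j) x) :
    ContinuousAt (fun y => eigval (H y) j) x := by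
  -- Take traces in `H P_j = λ_j P_j`.
  have h : (fun y => eigval (H y) j) = fun y =>
      ((H y : Matrix (Fin m) (Fin m) ℝ) * eigproj (H y) j).trace / (eigproj (H y) j).trace := by
    ext y
    rw [mul_eigproj, trace_smul, smul_eq_mul, mul_div_cancel_right₀ _ (trace_eigproj_ne_zero _ _)]
  have hc : Continuous fun M : Matrix (Fin m) (Fin m) ℝ => M.trace := continuous_id.matrix_trace
  rw [h]
  exact (hc.continuousAt.comp ((continuous_subtype_val.continuousAt.comp hH).mul hP)).div
    (hc.continuousAt.comp hP) (trace_eigproj_ne_zero _ _)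

/-- An eigenprojection of locally constant rank is continuous wherever its eigenvalue is. -/
theorem continuousAt_eigproj {E : Type*} [TopologicalSpace E] {m : ℕ}
    {H : E → SymMat m} {j : Fin m} {x : E} (hH : ContinuousAt H x)
    (hl : ContinuousAt (fun y => eigval (H y) j) x)
    (ht : ∀ᶠ y in 𝓝 x, (eigproj (H y) j).trace = (eigproj (H x) j).trace) :
    ContinuousAt (fun y => eigproj (H y) j) x := by
  set P₀ := eigproj (H x) j with hP₀
  set S := pseudoInv (H x) j with hS
  have hX : ContinuousAt (fun y => (H y : Matrix (Fin m) (Fin m) ℝ)) x :=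
    continuous_subtype_val.continuousAt.comp hH
  -- An orthogonal projection satisfies `‖P‖² = tr P`.
  have hbound : ∀ᶠ y in 𝓝 x, ‖eigproj (H y) j‖ ≤ √P₀.trace := by
    filter_upwards [ht] with y hy
    apply Real.le_sqrt_of_sq_le
    rw [sq_frobenius_norm_eq_trace, eigproj_transpose, eigproj_mul_self, hy]
  have hsmall : Tendsto (fun y => (1 - P₀) * eigproj (H y) j) (𝓝 x) (𝓝 0) := by
    have h : ∀ y, (1 - P₀) * eigproj (H y) j =
        (S * ((H y : Matrix (Fin m) (Fin m) ℝ) - H x) - (eigval (H y) j - eigval (H x) j) • S) *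
          eigproj (H y) j := by
      intro y
      rw [← pseudoInv_mul_sub]
      simp only [mul_sub, sub_mul, mul_assoc, mul_eigproj, mul_smul_comm, smul_mul_assoc, mul_one,
        sub_smul, hS]
      abel
    simp only [h]
    refine Tendsto.zero_mul_isBoundedUnder_le ?_ ⟨_, eventually_map.mpr hbound⟩
    have h1 : ContinuousAt (fun y => S * ((H y : Matrix (Fin m) (Fin m) ℝ) - H x) -
        (eigval (H y) j - eigval (H x) j) • S) x := by fun_prop
    have h2 := h1.tendsto
    simp only [sub_self, mul_zero, zero_smul] at h2
    exact h2
  have hc : Continuous fun M : Matrix (Fin m) (Fin m) ℝ => M.trace := continuous_id.matrix_trace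
  have htr : Tendsto (fun y => 2 * ((1 - P₀) * eigproj (H y) j).trace) (𝓝 x) (𝓝 0) := by
    simpa using ((hc.tendsto 0).comp hsmall).const_mul 2
  -- For projections of equal trace, `‖P - P₀‖² = tr P + tr P₀ - 2 tr (P₀ P) = 2 tr ((1 - P₀) P)`.
  have hsq : Tendsto (fun y => ‖eigproj (H y) j - P₀‖ ^ 2) (𝓝 x) (𝓝 0) := by
    refine htr.congr' ?_
    filter_upwards [ht] with y hy
    rw [sq_frobenius_norm_eq_trace, transpose_sub, hP₀, eigproj_transpose, eigproj_transpose,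
      Matrix.sub_mul, Matrix.one_mul]
    simp only [Matrix.sub_mul, Matrix.mul_sub, eigproj_mul_self, trace_sub,
      trace_mul_comm (eigproj (H y) j) (eigproj (H x) j), hy, hP₀]
    ring
  refine tendsto_iff_norm_sub_tendsto_zero.mpr ?_
  simpa using hsq.sqrt

/-! ### Differentiability. -/

/-- The derivative of an eigenprojection at a point of continuity. -/
theorem hasFDerivAt_eigproj {E : Type*} [NormedAddCommGroup E] [NormedSpace ℝ E] {m : ℕ}
    {H : E → SymMat m} {j : Fin m} {x : E}
    {H' : E →L[ℝ] Matrix (Fin m) (Fin m) ℝ} {L : E →L[ℝ] Matrix (Fin m) (Fin m) ℝ}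
    (hH : HasFDerivAt (fun y => (H y : Matrix (Fin m) (Fin m) ℝ)) H' x)
    (hl : ContinuousAt (fun y => eigval (H y) j) x)
    (hP : ContinuousAt (fun y => eigproj (H y) j) x)
    (hL : ∀ e, L e = eigproj (H x) j * H' e * pseudoInv (H x) j +
      pseudoInv (H x) j * H' e * eigproj (H x) j) :
    HasFDerivAt (fun y => eigproj (H y) j) L x := by
  set P₀ := eigproj (H x) j with hP₀
  set S := pseudoInv (H x) j with hS
  let D : E → Matrix (Fin m) (Fin m) ℝ := fun y => (H y : Matrix (Fin m) (Fin m) ℝ) - H x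
  let δ : E → ℝ := fun y => eigval (H y) j - eigval (H x) j
  let R : E → Matrix (Fin m) (Fin m) ℝ := fun y => eigproj (H y) j - P₀
  let T : E → Matrix (Fin m) (Fin m) ℝ := fun y =>
    S * D y * R y - δ y • (S * R y) + P₀ * R y * D y * S - δ y • (P₀ * R y * S) -
      P₀ * R y * R y * P₀
  have hR : ∀ y, R y = S * D y * P₀ + P₀ * D y * S + T y := fun y =>
    eigenprojection_sub_eq (eigproj_mul_self _ _) (eigproj_mul_self _ _) (mul_eigproj _ _)
      (eigproj_mul _ _) (pseudoInv_mul_eigproj _ _) (eigproj_mul_pseudoInv _ _)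
      (pseudoInv_mul_sub _ _) (sub_mul_pseudoInv _ _)
  have hD1 : D =o[𝓝 x] fun _ => (1 : ℝ) := by
    rw [isLittleO_one_iff]
    exact tendsto_sub_nhds_zero_iff.mpr hH.continuousAt
  have hδ1 : δ =o[𝓝 x] fun _ => (1 : ℝ) := by
    rw [isLittleO_one_iff]
    exact tendsto_sub_nhds_zero_iff.mpr hl
  have hR1 : R =o[𝓝 x] fun _ => (1 : ℝ) := by
    rw [isLittleO_one_iff]
    exact tendsto_sub_nhds_zero_iff.mpr hP
  have hRR : R =O[𝓝 x] fun y => ‖R y‖ := isBigO_norm_right.mpr (isBigO_refl _ _)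
  have hconst : ∀ M : Matrix (Fin m) (Fin m) ℝ, (fun _ : E => M) =O[𝓝 x] fun _ => (1 : ℝ) :=
    fun M => isBigO_const_const _ one_ne_zero _
  have hT : T =o[𝓝 x] R := by
    rw [← isLittleO_norm_right]
    have t1 : (fun y => S * D y * R y) =o[𝓝 x] fun y => ‖R y‖ := by
      simpa using ((hconst S).mul_isLittleO hD1).mul_isBigO hRR
    have t2 : (fun y => δ y • (S * R y)) =o[𝓝 x] fun y => ‖R y‖ := by
      simpa using hδ1.smul_isBigO ((hconst S).mul hRR)
    have t3 : (fun y => P₀ * R y * D y * S) =o[𝓝 x] fun y => ‖R y‖ := by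
      simpa using (((hconst P₀).mul hRR).mul_isLittleO hD1).mul_isBigO (hconst S)
    have t4 : (fun y => δ y • (P₀ * R y * S)) =o[𝓝 x] fun y => ‖R y‖ := by
      simpa using hδ1.smul_isBigO (((hconst P₀).mul hRR).mul (hconst S))
    have t5 : (fun y => P₀ * R y * R y * P₀) =o[𝓝 x] fun y => ‖R y‖ := by
      simpa using (((hconst P₀).mul hRR).mul_isLittleO hR1).mul_isBigO (hconst P₀)
    exact (((t1.sub t2).add t3).sub t4).sub t5
  have hDO : D =O[𝓝 x] fun y => ‖y - x‖ := isBigO_norm_right.mpr hH.isBigO_sub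
  have hRO : R =O[𝓝 x] fun y => y - x := by
    rw [← isBigO_norm_right]
    -- `T = o(R)` lets `R` be absorbed: `R = O(R - T)`, and `R - T` is linear in `D`.
    refine hT.right_isBigO_sub.trans ?_
    have h1 : (fun y => S * D y * P₀) =O[𝓝 x] fun y => ‖y - x‖ := by
      simpa using ((hconst S).mul hDO).mul (hconst P₀)
    have h2 : (fun y => P₀ * D y * S) =O[𝓝 x] fun y => ‖y - x‖ := by
      simpa using ((hconst P₀).mul hDO).mul (hconst S)
    refine (h1.add h2).congr_left fun y => ?_
    rw [hR y]
    abel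
  have hTo : T =o[𝓝 x] fun y => y - x := hT.trans_isBigO hRO
  have hDo : (fun y => D y - H' (y - x)) =o[𝓝 x] fun y => ‖y - x‖ :=
    isLittleO_norm_right.mpr hH.isLittleO
  have g1 : (fun y => S * (D y - H' (y - x)) * P₀) =o[𝓝 x] fun y => ‖y - x‖ := by
    simpa using ((hconst S).mul_isLittleO hDo).mul_isBigO (hconst P₀)
  have g2 : (fun y => P₀ * (D y - H' (y - x)) * S) =o[𝓝 x] fun y => ‖y - x‖ := by
    simpa using ((hconst P₀).mul_isLittleO hDo).mul_isBigO (hconst S)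
  refine .of_isLittleO (isLittleO_norm_right.mp
    (((g1.add g2).add (isLittleO_norm_right.mpr hTo)).congr_left fun y => ?_))
  change _ = R y - L (y - x)
  rw [hR y, hL]
  simp only [mul_sub, sub_mul]
  abel

/-! ### Jacobian derivatives, column by column. -/

theorem nabla_eq_of_hasFDerivAt {n m k : ℕ}
    {F : EuclideanSpace ℝ (Fin n) → Matrix (Fin m) (Fin k) ℝ}
    {F' : EuclideanSpace ℝ (Fin n) →L[ℝ] Matrix (Fin m) (Fin k) ℝ} {x : EuclideanSpace ℝ (Fin n)}
    (h : HasFDerivAt F F' x) (q : Fin k → ℝ) :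
    nabla q F x = Matrix.of fun i a => (F' (EuclideanSpace.single a 1)).mulVec q i := by
  let ev : Matrix (Fin m) (Fin k) ℝ →L[ℝ] EuclideanSpace ℝ (Fin m) :=
    LinearMap.toContinuousLinearMap
    { toFun := fun M => WithLp.toLp 2 (M.mulVec q)
      map_add' := fun M N => by rw [add_mulVec, WithLp.toLp_add]
      map_smul' := fun c M => by rw [smul_mulVec, WithLp.toLp_smul, RingHom.id_apply] }
  have h' : HasFDerivAt (fun y => WithLp.toLp 2 ((F y).mulVec q)) (ev.comp F') x :=
    ev.hasFDerivAt.comp x h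
  ext i a
  rw [nabla, jacobian, h'.fderiv]
  rfl

theorem mul_of_mulVec {n m k : ℕ} (B : Matrix (Fin m) (Fin m) ℝ)
    (G : Fin n → Matrix (Fin m) (Fin k) ℝ) (q : Fin k → ℝ) :
    B * (Matrix.of fun i a => (G a).mulVec q i) = Matrix.of fun i a => (B * G a).mulVec q i := by
  ext i a
  rw [mul_apply, of_apply, ← mulVec_mulVec]
  rfl

end Eigenproj

open Eigenproj

theorem theorem3p1 {n m : ℕ} (Ω : Set (EuclideanSpace ℝ (Fin n)))
    (hΩo : IsOpen Ω) (hΩc : IsConnected Ω)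
    (H : EuclideanSpace ℝ (Fin n) → Eigenproj.SymMat m) (hH : ContDiffOn ℝ 1 H Ω)
    (j : Fin m)
    (hyp : ContinuousOn (fun x => Eigenproj.eigproj (H x) j) Ω ∨
      (DifferentiableOn ℝ (fun x => Eigenproj.eigval (H x) j) Ω ∧
        ∃ d : ℝ, ∀ x ∈ Ω, (Eigenproj.eigproj (H x) j).trace = d)) :
    DifferentiableOn ℝ (fun x => Eigenproj.eigproj (H x) j) Ω ∧
    ∀ x ∈ Ω,
      (∀ q : Fin m → ℝ,
        Eigenproj.nabla q (fun y => Eigenproj.eigproj (H y) j) x =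
          Eigenproj.eigproj (H x) j *
              Eigenproj.nabla ((Eigenproj.pseudoInv (H x) j).mulVec q)
                (fun y => (H y : Matrix (Fin m) (Fin m) ℝ)) x +
            Eigenproj.pseudoInv (H x) j *
              Eigenproj.nabla ((Eigenproj.eigproj (H x) j).mulVec q)
                (fun y => (H y : Matrix (Fin m) (Fin m) ℝ)) x) ∧
      (∀ e : EuclideanSpace ℝ (Fin n),
        Eigenproj.dirDeriv e (fun y => Eigenproj.eigproj (H y) j) x =
          Eigenproj.eigproj (H x) j *
              Eigenproj.dirDeriv e (fun y => (H y : Matrix (Fin m) (Fin m) ℝ)) x *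
              Eigenproj.pseudoInv (H x) j +
            Eigenproj.pseudoInv (H x) j *
              Eigenproj.dirDeriv e (fun y => (H y : Matrix (Fin m) (Fin m) ℝ)) x *
              Eigenproj.eigproj (H x) j) := by
  have key : ∀ x ∈ Ω, ∃ H' L : EuclideanSpace ℝ (Fin n) →L[ℝ] Matrix (Fin m) (Fin m) ℝ,
      HasFDerivAt (fun y => (H y : Matrix (Fin m) (Fin m) ℝ)) H' x ∧
      (∀ e, L e = eigproj (H x) j * H' e * pseudoInv (H x) j +
        pseudoInv (H x) j * H' e * eigproj (H x) j) ∧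
      HasFDerivAt (fun y => eigproj (H y) j) L x := by
    intro x hx
    have hnhds : Ω ∈ nhds x := hΩo.mem_nhds hx
    have hHd : DifferentiableAt ℝ H x := (hH.differentiableOn one_ne_zero).differentiableAt hnhds
    have hval : HasFDerivAt (fun y => (H y : Matrix (Fin m) (Fin m) ℝ))
        ((SymMat m).subtypeL.comp (fderiv ℝ H x)) x :=
      (SymMat m).subtypeL.hasFDerivAt.comp x hHd.hasFDerivAt
    have hcont : ContinuousAt (fun y => eigval (H y) j) x ∧
        ContinuousAt (fun y => eigproj (H y) j) x := by
      rcases hyp with hP | ⟨hl, d, hd⟩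
      · have hPx := hP.continuousAt hnhds
        exact ⟨continuousAt_eigval hHd.continuousAt hPx, hPx⟩
      -- Only the continuity of `λ_j` is needed here.
      · have hlx := (hl.differentiableAt hnhds).continuousAt
        refine ⟨hlx, continuousAt_eigproj hHd.continuousAt hlx ?_⟩
        filter_upwards [hnhds] with y hy
        rw [hd y hy, hd x hx]
    let B : Matrix (Fin m) (Fin m) ℝ →L[ℝ] Matrix (Fin m) (Fin m) ℝ :=
      LinearMap.toContinuousLinearMap
        (LinearMap.mulLeftRight ℝ (eigproj (H x) j, pseudoInv (H x) j) +
          LinearMap.mulLeftRight ℝ (pseudoInv (H x) j, eigproj (H x) j))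
    refine ⟨_, B.comp ((SymMat m).subtypeL.comp (fderiv ℝ H x)), hval, fun e => ?_,
      hasFDerivAt_eigproj hval hcont.1 hcont.2 fun e => ?_⟩ <;> simp [B]
  refine ⟨fun x hx => ?_, fun x hx => ?_⟩
  · obtain ⟨_, _, -, -, h⟩ := key x hx
    exact h.differentiableAt.differentiableWithinAt
  · obtain ⟨H', L, hH', hL, hP⟩ := key x hx
    refine ⟨fun q => ?_, fun e => ?_⟩
    · rw [nabla_eq_of_hasFDerivAt hP, nabla_eq_of_hasFDerivAt hH', nabla_eq_of_hasFDerivAt hH',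
        mul_of_mulVec, mul_of_mulVec]
      ext i a
      simp [hL, Matrix.add_mulVec, Matrix.mulVec_mulVec]
    · rw [dirDeriv, dirDeriv, (hP.hasLineDerivAt e).lineDeriv, (hH'.hasLineDerivAt e).lineDeriv]
      exact hL e
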